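/- **Definitions.** Let $1\le m\le d$, let $e_i\in\mathbb R^d$ be the vector whose $i$-th coordinate is $1$ and whose other coordinates are $0$, let $k\ge 2$ be an integer, and let $\|\cdot\|$ be the Euclidean norm. A set $P\subseteq\mathbb R^d$ is an *arithmetic patch of size $k$ and scale $\Delta>0$ with orientation $\{e_1,\dots,e_m\}$* if $$P=\Big\{t+\Delta\sum_{i=1}^m x_ie_i : x_i\in\{0,1,\dots,k-1\}\Big\}\quad\text{for some } t\in\mathbb R^d.$$ A set $Q\subseteq\mathbb R^d$ is a *$(k,\varepsilon,\{e_1,\dots,e_m\})$-AP* if there are $\Delta>0$ and an arithmetic patch $P$ of size $k$ and scale $\Delta$ with orientation $\{e_1,\dots,e_m\}$ such that $$\sup_{x\in P}\inf_{y\in Q}\|x-y\|\le\varepsilon\Delta ,$$ where $\inf\emptyset=+\infty$. A finite family of contractions $(f_i)_i$ of $\mathbb R^d$ satisfies the *open set condition* if there is a nonempty bounded open set $V\subset\mathbb R^d$ with $\bigcup_i f_i(V)\subseteq V$, the sets $f_i(V)$ being pairwise disjoint. Its *attractor* is the unique nonempty compact set $F$ with $F=\bigcup_i f_i(F)$. **Theorem.**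 Let $k\ge 2$, $d\ge 1$ and $1\le m\le d$ be integers, where $k\ge 3$ if $d=1$. Let $0<\varepsilon<1/8$, $N=\lceil 1/(8\varepsilon)\rceil$ and $0<\delta\le 1/24$. Let $A$ be a nonempty subset of $\{0,1,\dots,N-1\}^d$ which does not contain any arithmetic patch of size $k$ (of any scale $\Delta>0$) with orientation $\{e_1,\dots,e_m\}$. For $a\in A$ and $x\in\mathbb R^d$ put $$\phi_a(x)=\frac{\delta}{N-1+\delta}\,x+a .$$ Then the family $(\phi_a)_{a\in A}$ has a unique attractor $F$, and the following hold: (i) the family $(\phi_a)_{a\in A}$ satisfies the open set condition; (ii) $F$ does not contain any $(k,\varepsilon,\{e_1,\dots,e_m\})$-AP; (iii) $\displaystyle \dim_{\mathrm H}F=\frac{\log|A|}{\log\left(\frac{N-1}{\delta}+1\right)}$, where $\dim_{\mathrm H}$ is the Hausdorff dimension. -/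

import Mathlib

/-- `P` is an arithmetic patch of size `k` and scale `Δ` with respect to the orientation
`v = (v₁, …, vₘ)`: `P = {t + Δ ∑ᵢ xᵢ vᵢ : xᵢ = 0, 1, …, k - 1}` for some `t`. -/
def IsArithmeticPatch {d m : ℕ} (k : ℕ) (Δ : ℝ) (v : Fin m → EuclideanSpace ℝ (Fin d))
    (P : Set (EuclideanSpace ℝ (Fin d))) : Prop :=
  ∃ t : EuclideanSpace ℝ (Fin d),
    P = Set.range (fun x : Fin m → Fin k => t + Δ • ∑ i, (((x i : ℕ) : ℝ) • v i))

/-- `Q` is a `(k, ε, v)`-AP: there is an arithmetic patch `P` of size `k` and some scale `Δ > 0`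
with orientation `v` such that `sup_{x ∈ P} inf_{y ∈ Q} ‖x - y‖ ≤ ε Δ`. The supremum and the
infimum are taken in `[0, ∞]`, so the empty set is not a `(k, ε, v)`-AP when `1 ≤ k`. -/
def IsApproxAP {d m : ℕ} (k : ℕ) (ε : ℝ) (v : Fin m → EuclideanSpace ℝ (Fin d))
    (Q : Set (EuclideanSpace ℝ (Fin d))) : Prop :=
  ∃ (Δ : ℝ) (P : Set (EuclideanSpace ℝ (Fin d))), 0 < Δ ∧ IsArithmeticPatch k Δ v P ∧
    (⨆ x ∈ P, ⨅ y ∈ Q, edist x y) ≤ ENNReal.ofReal (ε * Δ)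

/-- The orientation `(e₁, …, eₘ)` given by the first `m` standard unit vectors of `ℝᵈ`. -/
noncomputable def stdOrientation {d m : ℕ} (hmd : m ≤ d) (i : Fin m) :
    EuclideanSpace ℝ (Fin d) :=
  EuclideanSpace.single (Fin.castLE hmd i) (1 : ℝ)

/-- The grid `{0, 1, …, N - 1}ᵈ`, as a subset of `ℝᵈ`. -/
def gridCube (d N : ℕ) : Set (EuclideanSpace ℝ (Fin d)) :=
  {x | ∀ i, ∃ n : ℕ, n < N ∧ x i = (n : ℝ)}

/-- The similarity `φₐ(x) = δ / (N - 1 + δ) x + a` of `ℝᵈ`. -/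
noncomputable def gridMap {d : ℕ} (N : ℕ) (δ : ℝ) (a x : EuclideanSpace ℝ (Fin d)) :
    EuclideanSpace ℝ (Fin d) :=
  (δ / ((N : ℝ) - 1 + δ)) • x + a

/-- The open set condition for a family of maps of `ℝᵈ`. -/
def OpenSetCondition {d : ℕ} {ι : Type*}
    (f : ι → EuclideanSpace ℝ (Fin d) → EuclideanSpace ℝ (Fin d)) : Prop :=
  ∃ V : Set (EuclideanSpace ℝ (Fin d)), V.Nonempty ∧ IsOpen V ∧ Bornology.IsBounded V ∧
    (⋃ i, f i '' V) ⊆ V ∧ Pairwise (fun i j => Disjoint (f i '' V) (f j '' V))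

/-- `F` is an attractor of the family `f`: a nonempty compact set with `F = ⋃ᵢ fᵢ(F)`. -/
def IsAttractor {d : ℕ} {ι : Type*}
    (f : ι → EuclideanSpace ℝ (Fin d) → EuclideanSpace ℝ (Fin d))
    (F : Set (EuclideanSpace ℝ (Fin d))) : Prop :=
  F.Nonempty ∧ IsCompact F ∧ F = ⋃ i, f i '' F

/-!
Write `r = δ / (N - 1 + δ)` for the contraction ratio. Summing `∑ₙ rⁿ • ωₙ` over addresses
`ω : ℕ → A` gives a continuous coding map on a compact space, and every nonempty compact invariant
set equals its range: an invariant set contains the limits of the compositions of the maps along an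
address, and following inverse branches gives each of its points an address
(`eq_range_codingMap`). This is existence and uniqueness of the attractor `F`.

Since `r (N - 1 + δ) = δ`, each map sends the cube `[0, N - 1 + δ]ᵈ`, which contains `F`, to a cube
`a + [0, δ]ᵈ`. These small cubes are `1 - δ` apart, which gives the open set condition
(`openSetCondition_gridMap`). The covers of `F` by cylinders of level `n` bound the dimension from
above (`dimH_range_codingMap_le`). For the lower bound (`le_dimH_range_codingMap`), reading the
address of a point as the base-`|A|` digits of a real number maps `F` onto `[0, 1]`, and separation
makes this map Hölder with exponent `log |A| / log r⁻¹`; no measure on `F` is needed.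

Suppose that points `q_x` of `F` approximate a patch of scale `Δ` up to `ε Δ`. The extent of `F`
bounds `Δ`, and the choice of `N` makes `ε Δ + δ < 1/4`; hence the grid points `a_x` of the small
cubes containing the `q_x` lie within `1/4` of the patch in each coordinate. Differences of
neighbouring `a_x` are then integers determined by `Δ`, so that the `a_x` form a patch of scale
`round Δ` (`eq_add_round_smul_of_abs_sub_lt`). As `A` contains no patch, `round Δ = 0`, and all
`q_x` lie in one small cube. Undoing the map of that cube gives an approximate patch in `F` of scale
`Δ / r`; iterating contradicts the bound on the scale (`scale_le_of_approx_patch`).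
-/

open Set Filter Topology MeasureTheory
open scoped NNReal ENNReal

/-! ### The coding map of a self-similar system -/

section CodingMap

variable {E ι : Type*} [NormedAddCommGroup E] [NormedSpace ℝ E]

/-- The coding map of the self-similar system `x ↦ r • x + a i`: it sends the address `ω` to the
point `∑ₙ rⁿ • a (ω n)`, which is the limit of the compositions of the first `n` maps of the
address. -/
noncomputable def codingMap (r : ℝ) (a : ι → E) (ω : ℕ → ι) : E :=
  ∑' n, r ^ n • a (ω n)

theorem norm_pow_smul_le [Fintype ι] {r : ℝ} (hr : 0 ≤ r) (a : ι → E) (i : ι) (n : ℕ) :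
    ‖r ^ n • a i‖ ≤ r ^ n * ∑ j, ‖a j‖ := by
  rw [norm_smul, Real.norm_of_nonneg (by positivity)]
  gcongr
  exact Finset.single_le_sum (f := fun j => ‖a j‖) (fun _ _ => norm_nonneg _) (Finset.mem_univ i)

theorem summable_codingMap [CompleteSpace E] [Fintype ι] {r : ℝ} (hr : 0 ≤ r) (hr1 : r < 1)
    (a : ι → E) (ω : ℕ → ι) : Summable fun n => r ^ n • a (ω n) :=
  Summable.of_norm_bounded ((summable_geometric_of_lt_one hr hr1).mul_right _)
    fun n => norm_pow_smul_le hr a (ω n) n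

theorem isCompact_range_codingMap [CompleteSpace E] [Fintype ι] {r : ℝ} (hr : 0 ≤ r)
    (hr1 : r < 1) (a : ι → E) : IsCompact (range (codingMap r a)) := by
  let _ : TopologicalSpace ι := ⊥
  have : DiscreteTopology ι := ⟨rfl⟩
  refine isCompact_range (continuous_tsum (fun n => ?_)
    ((summable_geometric_of_lt_one hr hr1).mul_right (∑ j, ‖a j‖))
    fun n ω => norm_pow_smul_le hr a (ω n) n)
  exact continuous_const.smul (continuous_of_discreteTopology.comp (continuous_apply n))

theorem codingMap_eq_sum_add [CompleteSpace E] [Fintype ι] {r : ℝ} (hr : 0 ≤ r) (hr1 : r < 1)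
    (a : ι → E) (ω : ℕ → ι) (n : ℕ) :
    codingMap r a ω = ∑ i ∈ Finset.range n, r ^ i • a (ω i) +
      r ^ n • codingMap r a (fun i => ω (i + n)) := by
  have h := summable_codingMap hr hr1 a ω
  rw [codingMap, ← h.sum_add_tsum_nat_add n, codingMap, ← tsum_const_smul'']
  simp only [smul_smul, pow_add, mul_comm]

theorem codingMap_eq_add [CompleteSpace E] [Fintype ι] {r : ℝ} (hr : 0 ≤ r) (hr1 : r < 1)
    (a : ι → E) (ω : ℕ → ι) :
    codingMap r a ω = r • codingMap r a (fun i => ω (i + 1)) + a (ω 0) := by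
  rw [codingMap_eq_sum_add hr hr1 a ω 1, add_comm]
  simp

theorem range_codingMap_eq_iUnion [CompleteSpace E] [Fintype ι] {r : ℝ} (hr : 0 ≤ r)
    (hr1 : r < 1) (a : ι → E) :
    range (codingMap r a) = ⋃ i, (fun x => r • x + a i) '' range (codingMap r a) := by
  ext x
  simp only [mem_iUnion, mem_image, mem_range]
  constructor
  · rintro ⟨ω, rfl⟩
    exact ⟨ω 0, _, ⟨fun i => ω (i + 1), rfl⟩, (codingMap_eq_add hr hr1 a ω).symm⟩
  · rintro ⟨i, _, ⟨ω, rfl⟩, rfl⟩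
    exact ⟨fun n => Nat.casesOn n i ω, codingMap_eq_add hr hr1 a _⟩

/-- A point whose forward orbit under the inverse branches `x (n + 1) = r⁻¹ • (x n - a (ω n))`
stays bounded is the point with address `ω`. -/
theorem eq_codingMap_of_orbit [CompleteSpace E] [Fintype ι] {r : ℝ} (hr : 0 ≤ r) (hr1 : r < 1)
    {a : ι → E} {ω : ℕ → ι} {x : ℕ → E} {F : Set E} (hF : Bornology.IsBounded F)
    (hx : ∀ n, x n ∈ F) (hstep : ∀ n, x n = r • x (n + 1) + a (ω n)) :
    x 0 = codingMap r a ω := by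
  have hpart : ∀ n, ∑ i ∈ Finset.range n, r ^ i • a (ω i) = x 0 - r ^ n • x n := by
    intro n
    induction n with
    | zero => simp
    | succ n ih =>
      rw [Finset.sum_range_succ, ih, hstep n, pow_succ, smul_add, smul_smul]
      abel
  obtain ⟨C, hC⟩ := hF.exists_norm_le
  have h0 : Tendsto (fun n => r ^ n • x n) atTop (𝓝 0) := by
    refine squeeze_zero_norm (a := fun n => r ^ n * C) (fun n => ?_) ?_
    · rw [norm_smul, Real.norm_of_nonneg (by positivity)]
      gcongr
      exact hC _ (hx n)
    · simpa using (tendsto_pow_atTop_nhds_zero_of_lt_one hr hr1).mul_const C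
  have h1 := (summable_codingMap hr hr1 a ω).hasSum.tendsto_sum_nat
  simp only [hpart] at h1
  have h2 := (tendsto_const_nhds (x := x 0)).sub h0
  rw [sub_zero] at h2
  exact tendsto_nhds_unique h2 h1

/-- The range of the coding map is the only nonempty compact invariant set. -/
theorem eq_range_codingMap [CompleteSpace E] [Fintype ι] {r : ℝ} (hr : 0 ≤ r) (hr1 : r < 1)
    {a : ι → E} {F : Set E} (hne : F.Nonempty) (hF : IsCompact F)
    (h : F = ⋃ i, (fun x => r • x + a i) '' F) : F = range (codingMap r a) := by
  have hinv : ∀ i, ∀ x ∈ F, r • x + a i ∈ F := fun i x hx => by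
    rw [h]
    exact mem_iUnion.2 ⟨i, x, hx, rfl⟩
  apply Subset.antisymm
  · have hpre : ∀ x : F, ∃ (y : F) (i : ι), (x : E) = r • (y : E) + a i := by
      rintro ⟨x, hx⟩
      have hx' := hx
      rw [h] at hx'
      obtain ⟨i, y, hy, rfl⟩ := mem_iUnion.1 hx'
      exact ⟨⟨y, hy⟩, i, rfl⟩
    choose p j hp using hpre
    intro x hx
    refine ⟨fun n => j (p^[n] ⟨x, hx⟩), ?_⟩
    refine (eq_codingMap_of_orbit hr hr1 (x := fun n => ((p^[n] ⟨x, hx⟩ : F) : E)) hF.isBounded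
      (fun n => (p^[n] ⟨x, hx⟩).2) fun n => ?_).symm
    rw [hp (p^[n] ⟨x, hx⟩), Function.iterate_succ_apply']
  · rintro _ ⟨ω, rfl⟩
    obtain ⟨y, hy⟩ := hne
    -- The images of `y` under the first `n` maps of the address lie in `F` and converge.
    have hmem : ∀ (n : ℕ) (ω : ℕ → ι),
        ∑ i ∈ Finset.range n, r ^ i • a (ω i) + r ^ n • y ∈ F := by
      intro n
      induction n with
      | zero => intro ω; simpa using hy
      | succ n ih =>
        intro ω
        convert! hinv (ω 0) _ (ih fun i => ω (i + 1)) using 1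
        rw [Finset.sum_range_succ', smul_add, Finset.smul_sum, smul_smul, ← pow_succ']
        simp only [smul_smul, ← pow_succ', pow_zero, one_smul]
        abel
    have h1 := (summable_codingMap hr hr1 a ω).hasSum.tendsto_sum_nat
    have h2 := (tendsto_pow_atTop_nhds_zero_of_lt_one hr hr1).smul_const y
    have h3 := h1.add h2
    rw [zero_smul, add_zero] at h3
    exact hF.isClosed.mem_of_tendsto h3 (Eventually.of_forall fun n => hmem n ω)

/-! ### Hausdorff dimension of the limit set -/

theorem log_div_log_inv_nonneg {r : ℝ} (hr : 0 < r) (hr1 : r < 1) (b : ℕ) :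
    0 ≤ Real.log b / Real.log r⁻¹ :=
  div_nonneg (Real.log_natCast_nonneg b)
    (Real.log_nonneg (by rw [one_le_inv₀ hr]; exact hr1.le))

theorem rpow_similarityDim {r : ℝ} (hr : 0 < r) (hr1 : r < 1) {b : ℕ} (hb : 0 < b) :
    r ^ (Real.log b / Real.log r⁻¹) = (b : ℝ)⁻¹ := by
  have hlog : Real.log r ≠ 0 := (Real.log_neg hr hr1).ne
  have hb' : (0 : ℝ) < b := by exact_mod_cast hb
  rw [Real.rpow_def_of_pos hr, Real.log_inv, show Real.log r * (Real.log b / -Real.log r)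
    = -Real.log b by field_simp, Real.exp_neg, Real.exp_log hb']

/-- The covers by cylinders of level `n` bound the similarity-dimensional Hausdorff measure. -/
theorem dimH_range_codingMap_le [CompleteSpace E] [Fintype ι] [Nonempty ι] {r : ℝ} (hr : 0 < r)
    (hr1 : r < 1) (a : ι → E) :
    dimH (range (codingMap r a)) ≤
      ENNReal.ofReal (Real.log (Fintype.card ι) / Real.log r⁻¹) := by
  set b := Fintype.card ι with hb
  have hb0 : 0 < b := Fintype.card_pos
  set s := Real.log b / Real.log r⁻¹ with hs
  have hs0 : 0 ≤ s := log_div_log_inv_nonneg hr hr1 b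
  set F := range (codingMap r a) with hFdef
  have hF : IsCompact F := isCompact_range_codingMap hr.le hr1 a
  borelize E
  have hdiam : Metric.ediam F ≠ ∞ := hF.isBounded.ediam_ne_top
  set D := (Metric.ediam F).toNNReal with hD
  obtain ⟨ρ, hρ⟩ : ∃ ρ : ℝ≥0, (ρ : ℝ) = r := ⟨⟨r, hr.le⟩, rfl⟩
  let t : ∀ n : ℕ, (Fin n → ι) → Set E := fun n w =>
    (fun x => ∑ i : Fin n, r ^ (i : ℕ) • a (w i) + r ^ n • x) '' F
  have ht : ∀ n w, Metric.ediam (t n w) ≤ ((ρ ^ n * D : ℝ≥0) : ℝ≥0∞) := by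
    intro n w
    have hl : LipschitzWith (ρ ^ n)
        (fun x : E => ∑ i : Fin n, r ^ (i : ℕ) • a (w i) + r ^ n • x) := by
      refine LipschitzWith.of_dist_le_mul fun x y => ?_
      rw [dist_add_left, dist_smul₀, Real.norm_of_nonneg (by positivity)]
      simp [hρ]
    refine (hl.ediam_image_le F).trans ?_
    rw [ENNReal.coe_mul, hD, ENNReal.coe_toNNReal hdiam]
  have hcover : ∀ n, F ⊆ ⋃ w, t n w := by
    rintro n _ ⟨ω, rfl⟩
    refine mem_iUnion.2 ⟨fun i => ω i, codingMap r a (fun i => ω (i + n)), ⟨_, rfl⟩, ?_⟩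
    rw [codingMap_eq_sum_add hr.le hr1 a ω n, Finset.sum_range]
  have hlim : Tendsto (fun n : ℕ => ((ρ ^ n * D : ℝ≥0) : ℝ≥0∞)) atTop (𝓝 0) := by
    have h1 : Tendsto (fun n : ℕ => (ρ ^ n * D)) atTop (𝓝 0) := by
      have := (NNReal.tendsto_pow_atTop_nhds_zero_of_lt_one
        (show ρ < 1 by rw [← NNReal.coe_lt_coe, hρ]; exact hr1)).mul_const D
      simpa using this
    rw [← ENNReal.coe_zero]
    exact ENNReal.tendsto_coe.2 h1
  have hmeas := Measure.hausdorffMeasure_le_liminf_sum (X := E) s F (l := atTop) _ hlim t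
    (Eventually.of_forall fun n => ht n) (Eventually.of_forall hcover)
  have hsum : ∀ n, ∑ w, Metric.ediam (t n w) ^ s ≤ ((D ^ s : ℝ≥0) : ℝ≥0∞) := by
    intro n
    calc ∑ w, Metric.ediam (t n w) ^ s
        ≤ ∑ _w : Fin n → ι, ((ρ ^ n * D : ℝ≥0) : ℝ≥0∞) ^ s := by
          gcongr with w
          exact ht n w
      _ = (((b : ℝ≥0) ^ n * (ρ ^ n * D) ^ s : ℝ≥0) : ℝ≥0∞) := by
          rw [Finset.sum_const, nsmul_eq_mul, ← ENNReal.coe_rpow_of_nonneg _ hs0]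
          simp [hb]
      _ = ((D ^ s : ℝ≥0) : ℝ≥0∞) := by
          congr 1
          have hr' : ρ ^ s = (b : ℝ≥0)⁻¹ := by
            apply NNReal.eq
            rw [NNReal.coe_rpow, hρ, NNReal.coe_inv, NNReal.coe_natCast]
            exact rpow_similarityDim hr hr1 hb0
          have hb1 : (b : ℝ≥0) ≠ 0 := by exact_mod_cast hb0.ne'
          rw [NNReal.mul_rpow, ← NNReal.rpow_natCast ρ, ← NNReal.rpow_mul, mul_comm (n : ℝ),
            NNReal.rpow_mul, hr', NNReal.rpow_natCast, ← mul_assoc, ← mul_pow,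
            mul_inv_cancel₀ hb1, one_pow, one_mul]
  have hfin : μH[s] F ≠ ∞ := by
    refine ne_top_of_le_ne_top (b := ((D ^ s : ℝ≥0) : ℝ≥0∞)) ENNReal.coe_ne_top (hmeas.trans ?_)
    refine (liminf_le_liminf (Eventually.of_forall hsum)).trans ?_
    simp
  have := dimH_le_of_hausdorffMeasure_ne_top (d := s.toNNReal) (s := F)
    (by rwa [Real.coe_toNNReal _ hs0])
  exact this

/-- If the first-level cylinders are uniformly separated, points whose addresses first differ at
place `n` are at distance at least `c rⁿ`. -/
theorem mul_pow_le_dist_codingMap [CompleteSpace E] [Fintype ι] {r : ℝ} (hr : 0 < r)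
    (hr1 : r < 1) {a : ι → E} {c : ℝ}
    (hsep : ∀ ω η : ℕ → ι, ω 0 ≠ η 0 → c ≤ dist (codingMap r a ω) (codingMap r a η))
    {ω η : ℕ → ι} {n : ℕ} (hlt : ∀ i < n, ω i = η i) (hn : ω n ≠ η n) :
    c * r ^ n ≤ dist (codingMap r a ω) (codingMap r a η) := by
  rw [codingMap_eq_sum_add hr.le hr1 a ω n, codingMap_eq_sum_add hr.le hr1 a η n,
    Finset.sum_congr rfl fun i hi => by rw [hlt i (Finset.mem_range.1 hi)], dist_add_left,
    dist_smul₀, Real.norm_of_nonneg (by positivity), mul_comm]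
  gcongr
  exact hsep _ _ (by simpa using hn)

/-- The map reading the address of a point as the base-`b` digits of a real number is Hölder with
the similarity dimension as exponent, and it maps the limit set onto `[0, 1]`. -/
theorem le_dimH_range_codingMap [CompleteSpace E] [Fintype ι] {r : ℝ} (hr : 0 < r)
    (hr1 : r < 1) {a : ι → E} {c : ℝ} (hc : 0 < c)
    (hsep : ∀ ω η : ℕ → ι, ω 0 ≠ η 0 → c ≤ dist (codingMap r a ω) (codingMap r a η)) :
    ENNReal.ofReal (Real.log (Fintype.card ι) / Real.log r⁻¹) ≤
      dimH (range (codingMap r a)) := by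
  set b := Fintype.card ι with hb
  rcases Nat.lt_or_ge 1 b with hb1 | hb1
  swap
  · have : Real.log b = 0 := by interval_cases b <;> simp
    simp [this]
  set s := Real.log b / Real.log r⁻¹ with hs
  have hs0 : 0 < s := div_pos (Real.log_pos (by exact_mod_cast hb1))
    (Real.log_pos (one_lt_inv₀ hr |>.2 hr1))
  let e : ι ≃ Fin b := Fintype.equivFin ι
  have hsepn := @mul_pow_le_dist_codingMap E ι _ _ _ _ r hr hr1 a c hsep
  have hfirst : ∀ ω η : ℕ → ι, ω ≠ η → ∃ n, (∀ i < n, ω i = η i) ∧ ω n ≠ η n := by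
    intro ω η hne
    have hex := Function.ne_iff.1 hne
    classical
    exact ⟨Nat.find hex, fun i hi => not_not.1 (Nat.find_min hex hi), Nat.find_spec hex⟩
  have hinj : Function.Injective (codingMap r a) := by
    intro ω η h
    by_contra hne
    obtain ⟨n, h1, h2⟩ := hfirst ω η hne
    have := hsepn h1 h2
    rw [h, dist_self] at this
    exact absurd this (not_le.2 (by positivity))
  obtain ⟨i₀⟩ : Nonempty ι := Fintype.card_pos_iff.1 (by omega)
  have : Nonempty (ℕ → ι) := ⟨fun _ => i₀⟩
  let g : E → ℝ := fun x => Real.ofDigits fun n => e (Function.invFun (codingMap r a) x n)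
  have hg : ∀ ω, g (codingMap r a ω) = Real.ofDigits fun n => e (ω n) := fun ω => by
    simp only [g, Function.leftInverse_invFun hinj ω]
  have hholder : HolderOnWith ((c⁻¹).toNNReal ^ s) s.toNNReal g (range (codingMap r a)) := by
    rintro _ ⟨ω, rfl⟩ _ ⟨η, rfl⟩
    rcases eq_or_ne ω η with rfl | hne
    · simp
    obtain ⟨n, h1, h2⟩ := hfirst ω η hne
    have hd := hsepn h1 h2
    have key : dist (g (codingMap r a ω)) (g (codingMap r a η)) ≤
        c⁻¹ ^ s * dist (codingMap r a ω) (codingMap r a η) ^ s := by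
      rw [hg, hg, Real.dist_eq]
      refine (Real.abs_ofDigits_sub_ofDigits_le (n := n) fun i hi => by rw [h1 i hi]).trans ?_
      calc ((b : ℝ) ^ n)⁻¹ = (c⁻¹ * (c * r ^ n)) ^ s := by
            rw [inv_mul_cancel_left₀ hc.ne', ← Real.rpow_natCast r, ← Real.rpow_mul hr.le,
              mul_comm, Real.rpow_mul hr.le, rpow_similarityDim hr hr1 (by omega),
              Real.rpow_natCast, inv_pow]
        _ ≤ (c⁻¹ * dist (codingMap r a ω) (codingMap r a η)) ^ s := by gcongr
        _ = _ := Real.mul_rpow (by positivity) dist_nonneg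
    rw [edist_dist, edist_dist, Real.coe_toNNReal _ hs0.le,
      ENNReal.ofReal_rpow_of_nonneg dist_nonneg hs0.le, ENNReal.coe_rpow_of_nonneg _ hs0.le,
      ← ENNReal.ofReal.eq_1, ENNReal.ofReal_rpow_of_nonneg (by positivity) hs0.le,
      ← ENNReal.ofReal_mul (by positivity)]
    exact ENNReal.ofReal_le_ofReal key
  have himage : Icc (0 : ℝ) 1 ⊆ g '' range (codingMap r a) := by
    intro y hy
    obtain ⟨x, -, rfl⟩ := Real.ofDigits_SurjOn hb1 hy
    refine ⟨_, ⟨fun n => e.symm (x n), rfl⟩, ?_⟩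
    simp [hg]
  have hone : dimH (Icc (0 : ℝ) 1) = 1 := by
    rw [Real.dimH_of_nonempty_interior (by simp [interior_Icc])]
    simp
  have hle := (dimH_mono himage).trans (hholder.dimH_image_le (Real.toNNReal_pos.2 hs0))
  rw [hone, ENNReal.le_div_iff_mul_le (by simp [hs0]) (by simp), one_mul] at hle
  exact hle

end CodingMap

/-! ### Integer points close to an arithmetic patch -/

/-- Integers within `1/4` of the terms of an arithmetic progression with difference `Δ` form an
arithmetic progression whose difference is the integer nearest to `Δ`. -/
theorem eq_add_round_mul_of_abs_sub_lt {X : Type*} {t Δ : ℝ} {a : X → ℤ} {c : X → ℕ}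
    (h : ∀ x, |(a x : ℝ) - (t + Δ * c x)| < 1 / 4) (hc : ∀ x, ∀ n ≤ c x, ∃ y, c y = n)
    (n : ℕ) : ∀ x y, c x = c y + n → a x = a y + round Δ * n := by
  induction n with
  | zero =>
    intro x y hxy
    have hx := abs_lt.1 (h x)
    have hy := abs_lt.1 (h y)
    rw [hxy, add_zero] at hx
    have h1 : a x < a y + 1 := by
      rify; linarith [hx.2, hy.1]
    have h2 : a y < a x + 1 := by
      rify; linarith [hx.1, hy.2]
    push_cast
    omega
  | succ n ih =>
    intro x y hxy
    obtain ⟨z, hz⟩ := hc x (c y + n) (by omega)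
    have hx := abs_lt.1 (h x)
    have hz' := abs_lt.1 (h z)
    have hR := abs_le.1 (abs_sub_round Δ)
    rw [show c x = c z + 1 by omega] at hx
    push_cast at hx
    rw [mul_add] at hx
    have h1 : a x < a z + round Δ + 1 := by
      rify; linarith [hx.2, hz'.1, hR.2]
    have h2 : a z + round Δ < a x + 1 := by
      rify; linarith [hx.1, hz'.2, hR.1]
    have h3 := ih z y hz
    push_cast
    rw [mul_add]
    omega

/-- The `j`-th coordinate of the patch point with parameters `x`, for the patch with `t = 0` and
`Δ = 1`. -/
def patchCoord {d m k : ℕ} (j : Fin d) (x : Fin m → Fin k) : ℕ :=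
  if h : (j : ℕ) < m then (x ⟨j, h⟩ : ℕ) else 0

theorem sum_smul_stdOrientation_apply {d m k : ℕ} (hmd : m ≤ d) (x : Fin m → Fin k)
    (j : Fin d) :
    (∑ i, (((x i : ℕ) : ℝ) • stdOrientation hmd i)) j = (patchCoord j x : ℝ) := by
  simp only [stdOrientation, patchCoord, WithLp.ofLp_sum, Finset.sum_apply, WithLp.ofLp_smul,
    Pi.smul_apply, PiLp.single_apply, smul_eq_mul, mul_ite, mul_one, mul_zero]
  split_ifs with h
  · rw [Finset.sum_eq_single ⟨j, h⟩]
    · simp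
    · intro i _ hi
      rw [if_neg]
      contrapose! hi
      simp [hi]
    · simp
  · push_cast
    refine Finset.sum_eq_zero fun i _ => if_neg ?_
    rintro rfl
    exact h i.2

theorem exists_patchCoord_eq {d m k : ℕ} (j : Fin d) (x : Fin m → Fin k) (n : ℕ)
    (hn : n ≤ patchCoord j x) : ∃ y : Fin m → Fin k, patchCoord j y = n := by
  unfold patchCoord at hn ⊢
  split_ifs at hn ⊢ with h
  · exact ⟨fun _ => ⟨n, hn.trans_lt (x ⟨j, h⟩).2⟩, rfl⟩
  · exact ⟨x, by omega⟩

/-- Grid points within `1/4`, in each coordinate, of the points of an arithmetic patch of scale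
`Δ` form the patch whose scale is the integer nearest to `Δ`. -/
theorem eq_add_round_smul_of_abs_sub_lt {d m k N : ℕ} [NeZero k] (hmd : m ≤ d)
    {t : Fin d → ℝ} {Δ : ℝ}
    {a : (Fin m → Fin k) → EuclideanSpace ℝ (Fin d)} (ha : ∀ x, a x ∈ gridCube d N)
    (h : ∀ x j, |a x j - (t j + Δ * patchCoord j x)| < 1 / 4) (x : Fin m → Fin k) :
    a x = a 0 + (round Δ : ℝ) • ∑ i, (((x i : ℕ) : ℝ) • stdOrientation hmd i) := by
  choose b hb using fun x j => (ha x j)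
  ext j
  have h0 : patchCoord j (0 : Fin m → Fin k) = 0 := by
    unfold patchCoord
    split_ifs <;> simp
  have := eq_add_round_mul_of_abs_sub_lt (t := t j) (Δ := Δ) (a := fun x => (b x j : ℤ))
    (c := patchCoord j) (fun x => by simpa [(hb x j).2] using h x j)
    (exists_patchCoord_eq j) (patchCoord j x) x 0 (by rw [h0, zero_add])
  simp only [PiLp.add_apply, PiLp.smul_apply, smul_eq_mul, sum_smul_stdOrientation_apply]
  rw [(hb x j).2, (hb 0 j).2]
  exact_mod_cast this

/-! ### The grid system -/

section GridSystem

variable {d N : ℕ} {δ : ℝ}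

theorem apply_nonneg_of_mem_gridCube {a : EuclideanSpace ℝ (Fin d)} (ha : a ∈ gridCube d N)
    (j : Fin d) : 0 ≤ a j := by
  obtain ⟨n, -, h⟩ := ha j
  rw [h]
  positivity

theorem apply_le_of_mem_gridCube {a : EuclideanSpace ℝ (Fin d)} (ha : a ∈ gridCube d N)
    (j : Fin d) : a j ≤ (N : ℝ) - 1 := by
  obtain ⟨n, hn, h⟩ := ha j
  have hn' : (n : ℝ) + 1 ≤ N := by exact_mod_cast hn
  rw [h]
  linarith

theorem exists_one_le_abs_sub_of_mem_gridCube {a b : EuclideanSpace ℝ (Fin d)}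
    (ha : a ∈ gridCube d N) (hb : b ∈ gridCube d N) (hab : a ≠ b) :
    ∃ j, 1 ≤ |a j - b j| := by
  by_contra! h
  refine hab (PiLp.ext fun j => ?_)
  obtain ⟨p, -, hp⟩ := ha j
  obtain ⟨q, -, hq⟩ := hb j
  have := h j
  rw [hp, hq] at this ⊢
  have h1 : |(p : ℤ) - q| < 1 := by
    rify
    exact this
  rw [Int.abs_lt_one_iff] at h1
  have h2 : p = q := by omega
  rw [h2]

/-- A map of the system sends the cube `[0, N - 1 + δ]ᵈ` to a cube of side `δ`. -/
theorem gridMap_ratio_mul_side (hN : 2 ≤ N) (hδ : 0 < δ) :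
    δ / ((N : ℝ) - 1 + δ) * ((N : ℝ) - 1 + δ) = δ := by
  have : (2 : ℝ) ≤ N := by exact_mod_cast hN
  exact div_mul_cancel₀ _ (by linarith)

theorem gridMap_ratio_pos (hN : 2 ≤ N) (hδ : 0 < δ) : 0 < δ / ((N : ℝ) - 1 + δ) := by
  have : (2 : ℝ) ≤ N := by exact_mod_cast hN
  exact div_pos hδ (by linarith)

theorem gridMap_ratio_lt_one (hN : 2 ≤ N) (hδ : 0 < δ) : δ / ((N : ℝ) - 1 + δ) < 1 := by
  have : (2 : ℝ) ≤ N := by exact_mod_cast hN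
  rw [div_lt_one (by linarith)]
  linarith

theorem exists_eq_gridMap_of_mem {A : Finset (EuclideanSpace ℝ (Fin d))}
    {F : Set (EuclideanSpace ℝ (Fin d))} (hF : IsAttractor (fun a : A => gridMap N δ a) F)
    {x : EuclideanSpace ℝ (Fin d)} (hx : x ∈ F) :
    ∃ a ∈ A, ∃ y ∈ F, x = gridMap N δ a y := by
  rw [hF.2.2] at hx
  obtain ⟨⟨a, ha⟩, y, hy, rfl⟩ := mem_iUnion.1 hx
  exact ⟨a, ha, y, hy, rfl⟩

/-- The attractor is contained in the cube `[0, N - 1 + δ]ᵈ`. -/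
theorem attractor_apply_mem_Icc {A : Finset (EuclideanSpace ℝ (Fin d))}
    (hAN : (A : Set (EuclideanSpace ℝ (Fin d))) ⊆ gridCube d N) (hN : 2 ≤ N) (hδ : 0 < δ)
    {F : Set (EuclideanSpace ℝ (Fin d))} (hF : IsAttractor (fun a : A => gridMap N δ a) F)
    {x : EuclideanSpace ℝ (Fin d)} (hx : x ∈ F) (j : Fin d) :
    x j ∈ Icc 0 ((N : ℝ) - 1 + δ) := by
  have hr := gridMap_ratio_pos hN hδ
  have hr1 := gridMap_ratio_lt_one hN hδ
  have hside := gridMap_ratio_mul_side hN hδ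
  set r := δ / ((N : ℝ) - 1 + δ) with hrdef
  have hcont : ContinuousOn (fun x : EuclideanSpace ℝ (Fin d) => x j) F := by fun_prop
  have hstep : ∀ z ∈ F, ∃ y ∈ F, r * y j ≤ z j ∧ z j ≤ r * y j + ((N : ℝ) - 1) := by
    intro z hz
    obtain ⟨a, ha, y, hy, rfl⟩ := exists_eq_gridMap_of_mem hF hz
    refine ⟨y, hy, ?_⟩
    simp only [gridMap, PiLp.add_apply, PiLp.smul_apply, smul_eq_mul, ← hrdef]
    exact ⟨by linarith [apply_nonneg_of_mem_gridCube (hAN ha) j],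
      by linarith [apply_le_of_mem_gridCube (hAN ha) j]⟩
  -- The extreme values of the coordinate are attained, and are bounded by invariance.
  constructor
  · obtain ⟨z, hz, hmin⟩ := hF.2.1.exists_isMinOn hF.1 hcont
    obtain ⟨y, hy, h1, -⟩ := hstep z hz
    have h2 : z j ≤ y j := hmin hy
    have h3 : z j ≤ x j := hmin hx
    nlinarith
  · obtain ⟨z, hz, hmax⟩ := hF.2.1.exists_isMaxOn hF.1 hcont
    obtain ⟨y, hy, -, h1⟩ := hstep z hz
    have h2 : y j ≤ z j := hmax hy
    have h3 : x j ≤ z j := hmax hx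
    nlinarith

theorem gridMap_apply_mem_Icc (hN : 2 ≤ N) (hδ : 0 < δ) (a : EuclideanSpace ℝ (Fin d))
    {y : EuclideanSpace ℝ (Fin d)} {j : Fin d} (hy : y j ∈ Icc 0 ((N : ℝ) - 1 + δ)) :
    gridMap N δ a y j ∈ Icc (a j) (a j + δ) := by
  have hr := gridMap_ratio_pos hN hδ
  have hside := gridMap_ratio_mul_side hN hδ
  simp only [gridMap, PiLp.add_apply, PiLp.smul_apply, smul_eq_mul]
  constructor
  · linarith [mul_nonneg hr.le hy.1]
  · linarith [mul_le_mul_of_nonneg_left hy.2 hr.le]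

/-- Images of the cube `[0, N - 1 + δ]ᵈ` under two different maps of the system are at distance at
least `1 - δ`. -/
theorem one_sub_le_dist_gridMap (hN : 2 ≤ N) (hδ : 0 < δ) {a b : EuclideanSpace ℝ (Fin d)}
    (ha : a ∈ gridCube d N) (hb : b ∈ gridCube d N) (hab : a ≠ b)
    {x y : EuclideanSpace ℝ (Fin d)} (hx : ∀ j, x j ∈ Icc 0 ((N : ℝ) - 1 + δ))
    (hy : ∀ j, y j ∈ Icc 0 ((N : ℝ) - 1 + δ)) :
    1 - δ ≤ dist (gridMap N δ a x) (gridMap N δ b y) := by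
  obtain ⟨j, hj⟩ := exists_one_le_abs_sub_of_mem_gridCube ha hb hab
  have h1 := gridMap_apply_mem_Icc hN hδ a (hx j)
  have h2 := gridMap_apply_mem_Icc hN hδ b (hy j)
  have h3 : |gridMap N δ a x j - gridMap N δ b y j| ≤
      dist (gridMap N δ a x) (gridMap N δ b y) := by
    rw [dist_eq_norm, ← Real.norm_eq_abs, ← PiLp.sub_apply]
    exact PiLp.norm_apply_le _ j
  refine le_trans ?_ h3
  rcases le_abs.1 hj with h | h
  · exact le_trans (by linarith [h1.1, h2.2]) (le_abs_self _)
  · exact le_trans (by linarith [h1.2, h2.1]) (neg_le_abs _)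

/-- The open cube `(0, N - 1 + δ)ᵈ` witnesses the open set condition. -/
theorem openSetCondition_gridMap {A : Finset (EuclideanSpace ℝ (Fin d))}
    (hAN : (A : Set (EuclideanSpace ℝ (Fin d))) ⊆ gridCube d N) (hN : 2 ≤ N) (hδ : 0 < δ)
    (hδ1 : δ < 1) :
    OpenSetCondition (fun a : A => gridMap N δ (a : EuclideanSpace ℝ (Fin d))) := by
  have hN' : (2 : ℝ) ≤ N := by exact_mod_cast hN
  have hr := gridMap_ratio_pos hN hδ
  have hside := gridMap_ratio_mul_side hN hδ
  refine ⟨{x | ∀ j, x j ∈ Ioo 0 ((N : ℝ) - 1 + δ)}, ⟨WithLp.toLp 2 fun _ => ((N : ℝ) - 1 + δ) / 2,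
    fun j => ⟨?_, ?_⟩⟩, ?_, ?_, ?_, ?_⟩
  · change 0 < ((N : ℝ) - 1 + δ) / 2
    linarith
  · change ((N : ℝ) - 1 + δ) / 2 < (N : ℝ) - 1 + δ
    linarith
  · rw [ofPred_forall]
    refine isOpen_iInter_of_finite fun j => ?_
    exact isOpen_Ioo.preimage (by fun_prop : Continuous fun x : EuclideanSpace ℝ (Fin d) => x j)
  · refine ((PiLp.antilipschitzWith_ofLp 2 fun _ : Fin d => ℝ).isBounded_preimage
      (Metric.isBounded_Icc (0 : Fin d → ℝ) fun _ => (N : ℝ) - 1 + δ)).subset ?_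
    exact fun x hx => ⟨fun j => (hx j).1.le, fun j => (hx j).2.le⟩
  · refine iUnion_subset fun a => ?_
    rintro _ ⟨x, hx, rfl⟩ j
    have h1 := apply_nonneg_of_mem_gridCube (hAN a.2) j
    have h2 := apply_le_of_mem_gridCube (hAN a.2) j
    have h3 := mul_pos hr (hx j).1
    have h4 := mul_lt_mul_of_pos_left (hx j).2 hr
    simp only [gridMap, PiLp.add_apply, PiLp.smul_apply, smul_eq_mul]
    constructor <;> linarith
  · intro a b hab
    refine Set.disjoint_left.2 ?_
    rintro _ ⟨x, hx, rfl⟩ ⟨y, hy, hxy⟩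
    have := one_sub_le_dist_gridMap hN hδ (hAN a.2) (hAN b.2) (Subtype.coe_ne_coe.2 hab)
      (fun j => Ioo_subset_Icc_self (hx j)) (fun j => Ioo_subset_Icc_self (hy j))
    rw [show gridMap N δ b y = gridMap N δ a x from hxy, dist_self] at this
    linarith

theorem isAttractor_gridMap_iff {A : Finset (EuclideanSpace ℝ (Fin d))} (hA : A.Nonempty)
    (hN : 2 ≤ N) (hδ : 0 < δ) {F : Set (EuclideanSpace ℝ (Fin d))} :
    IsAttractor (fun a : A => gridMap N δ a) F ↔
      F = range (codingMap (δ / ((N : ℝ) - 1 + δ))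
        (fun a : A => (a : EuclideanSpace ℝ (Fin d)))) := by
  have hr := gridMap_ratio_pos hN hδ
  have hr1 := gridMap_ratio_lt_one hN hδ
  have : Nonempty A := hA.to_subtype
  constructor
  · rintro ⟨hne, hcpt, h⟩
    exact eq_range_codingMap hr.le hr1 hne hcpt h
  · rintro rfl
    exact ⟨range_nonempty _, isCompact_range_codingMap hr.le hr1 _,
      range_codingMap_eq_iUnion hr.le hr1 _⟩

theorem dimH_attractor_gridMap {A : Finset (EuclideanSpace ℝ (Fin d))} (hA : A.Nonempty)
    (hAN : (A : Set (EuclideanSpace ℝ (Fin d))) ⊆ gridCube d N) (hN : 2 ≤ N) (hδ : 0 < δ)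
    (hδ1 : δ < 1) {F : Set (EuclideanSpace ℝ (Fin d))}
    (hF : IsAttractor (fun a : A => gridMap N δ a) F) :
    dimH F = ENNReal.ofReal
      (Real.log (A.card : ℝ) / Real.log (((N : ℝ) - 1) / δ + 1)) := by
  have hr := gridMap_ratio_pos hN hδ
  have hr1 := gridMap_ratio_lt_one hN hδ
  have : Nonempty A := hA.to_subtype
  have hbox := fun x (hx : x ∈ F) => attractor_apply_mem_Icc hAN hN hδ hF hx
  have hF' := (isAttractor_gridMap_iff hA hN hδ).1 hF
  have hinv : ((N : ℝ) - 1) / δ + 1 = (δ / ((N : ℝ) - 1 + δ))⁻¹ := by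
    rw [inv_div, add_div, div_self hδ.ne']
  rw [hinv, ← Fintype.card_coe A]
  rw [hF'] at hbox ⊢
  refine le_antisymm (dimH_range_codingMap_le hr hr1 _)
    (le_dimH_range_codingMap hr hr1 (sub_pos.2 hδ1) fun ω η hne => ?_)
  rw [codingMap_eq_add hr.le hr1 _ ω, codingMap_eq_add hr.le hr1 _ η]
  exact one_sub_le_dist_gridMap hN hδ (hAN (ω 0).2) (hAN (η 0).2) (Subtype.coe_ne_coe.2 hne)
    (hbox _ ⟨_, rfl⟩) (hbox _ ⟨_, rfl⟩)

/-! ### Approximate patches in the attractor -/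

/-- The extent of the attractor bounds the scale of an approximate patch. The points of such a patch
all lie in the same first-level piece, since otherwise the pieces that contain them give a patch
in `A`; rescaling that piece to the attractor improves the bound by the contraction ratio, and this
can be repeated. -/
theorem scale_le_of_approx_patch {k m : ℕ} (hk : 2 ≤ k) (hm : 1 ≤ m) (hmd : m ≤ d)
    {ε : ℝ} (hε : 0 < ε) (hε' : ε < 1 / 8) (hN : 2 ≤ N) (hεN : ε * ((N : ℝ) - 1) ≤ 1 / 8)
    (hδ : 0 < δ) (hδ' : δ ≤ 1 / 24) {A : Finset (EuclideanSpace ℝ (Fin d))}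
    (hAN : (A : Set (EuclideanSpace ℝ (Fin d))) ⊆ gridCube d N)
    (hAP : ∀ P ⊆ (A : Set (EuclideanSpace ℝ (Fin d))), ∀ Δ : ℝ, 0 < Δ →
      ¬ IsArithmeticPatch k Δ (stdOrientation hmd) P)
    {F : Set (EuclideanSpace ℝ (Fin d))} (hF : IsAttractor (fun a : A => gridMap N δ a) F)
    (n : ℕ) : ∀ (t : Fin d → ℝ) (Δ : ℝ), 0 < Δ →
      ∀ q : (Fin m → Fin k) → EuclideanSpace ℝ (Fin d), (∀ x, q x ∈ F) →
      (∀ x j, |q x j - (t j + Δ * patchCoord j x)| ≤ ε * Δ) →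
      Δ ≤ (δ / ((N : ℝ) - 1 + δ)) ^ n * (4 / 3 * ((N : ℝ) - 1 + δ)) := by
  have : NeZero k := ⟨by omega⟩
  have hr := gridMap_ratio_pos hN hδ
  have hbox := fun x (hx : x ∈ F) => attractor_apply_mem_Icc hAN hN hδ hF hx
  have hsize : ∀ (t : Fin d → ℝ) (Δ : ℝ), 0 < Δ →
      ∀ q : (Fin m → Fin k) → EuclideanSpace ℝ (Fin d), (∀ x, q x ∈ F) →
      (∀ x j, |q x j - (t j + Δ * patchCoord j x)| ≤ ε * Δ) →
      Δ ≤ 4 / 3 * ((N : ℝ) - 1 + δ) := by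
    intro t Δ hΔ q hq h
    let j : Fin d := ⟨0, by omega⟩
    let x : Fin m → Fin k := fun _ => ⟨1, by omega⟩
    have h0 : patchCoord j (0 : Fin m → Fin k) = 0 := by simp [patchCoord]
    have h1 : patchCoord j x = 1 := by simp [patchCoord, x, j]; omega
    have e0 := (abs_le.1 (h 0 j)).2
    have e1 := (abs_le.1 (h x j)).1
    rw [h0] at e0
    rw [h1] at e1
    push_cast at e0 e1
    have b0 := (hbox _ (hq 0) j).1
    have b1 := (hbox _ (hq x) j).2
    nlinarith
  induction n with
  | zero => simpa using hsize
  | succ n ih =>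
    intro t Δ hΔ q hq h
    have hs := hsize t Δ hΔ q hq h
    choose a ha y hy hqy using fun x => exists_eq_gridMap_of_mem hF (hq x)
    have hclose : ∀ x j, |a x j - (t j + Δ * patchCoord j x)| < 1 / 4 := by
      intro x j
      have h1 := gridMap_apply_mem_Icc hN hδ (a x) (hbox _ (hy x) j)
      rw [← hqy] at h1
      have h2 := abs_le.1 (h x j)
      -- The error is at most `ε Δ + δ ≤ (4/3) (1/8) (1 + 1/24) + 1/24 = 31/144`.
      have h3 : ε * Δ ≤ 25 / 144 := by nlinarith
      rw [abs_lt]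
      constructor <;> linarith [h1.1, h1.2]
    have hpatch := eq_add_round_smul_of_abs_sub_lt hmd (fun x => hAN (ha x)) hclose
    have hround : round Δ = 0 := by
      have h0 : (0 : ℤ) ≤ round Δ := by
        rw [round_eq]
        exact Int.floor_nonneg.2 (by linarith)
      refine (h0.eq_or_lt.resolve_right fun hpos => ?_).symm
      refine hAP (range a) (range_subset_iff.2 ha) (round Δ : ℝ) (by exact_mod_cast hpos)
        ⟨a 0, ?_⟩
      exact congrArg range (funext hpatch)
    simp only [hround, Int.cast_zero, zero_smul, add_zero] at hpatch
    have hscale := ih (fun j => (t j - a 0 j) / (δ / ((N : ℝ) - 1 + δ)))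
      (Δ / (δ / ((N : ℝ) - 1 + δ))) (div_pos hΔ hr) y hy fun x j => ?_
    · rwa [div_le_iff₀ hr, mul_right_comm, ← pow_succ] at hscale
    · have h1 : q x j = δ / ((N : ℝ) - 1 + δ) * y x j + a 0 j := by
        rw [hqy x, hpatch x]
        rfl
      have h2 := h x j
      set r := δ / ((N : ℝ) - 1 + δ) with hrdef
      have h3 : y x j - ((t j - a 0 j) / r + Δ / r * patchCoord j x) =
          (q x j - (t j + Δ * patchCoord j x)) / r := by
        rw [h1]
        field_simp
        ring
      rw [h3, abs_div, abs_of_pos hr, ← mul_div_assoc]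
      gcongr

theorem not_isApproxAP_of_subset_attractor {k m : ℕ} (hk : 2 ≤ k) (hm : 1 ≤ m) (hmd : m ≤ d)
    {ε : ℝ} (hε : 0 < ε) (hε' : ε < 1 / 8) (hN : 2 ≤ N) (hεN : ε * ((N : ℝ) - 1) ≤ 1 / 8)
    (hδ : 0 < δ) (hδ' : δ ≤ 1 / 24) {A : Finset (EuclideanSpace ℝ (Fin d))}
    (hAN : (A : Set (EuclideanSpace ℝ (Fin d))) ⊆ gridCube d N)
    (hAP : ∀ P ⊆ (A : Set (EuclideanSpace ℝ (Fin d))), ∀ Δ : ℝ, 0 < Δ →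
      ¬ IsArithmeticPatch k Δ (stdOrientation hmd) P)
    {F : Set (EuclideanSpace ℝ (Fin d))} (hF : IsAttractor (fun a : A => gridMap N δ a) F)
    {Q : Set (EuclideanSpace ℝ (Fin d))} (hQ : Q ⊆ F) :
    ¬ IsApproxAP k ε (stdOrientation hmd) Q := by
  rintro ⟨Δ, _, hΔ, ⟨t, rfl⟩, hsup⟩
  -- The infimum over `Q` need not be attained, but the one over the compact set `F` is.
  have hex : ∀ x : Fin m → Fin k, ∃ q ∈ F,
      dist (t + Δ • ∑ i, (((x i : ℕ) : ℝ) • stdOrientation hmd i)) q ≤ ε * Δ := by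
    intro x
    obtain ⟨q, hq, heq⟩ := hF.2.1.exists_infEDist_eq_edist hF.1
      (t + Δ • ∑ i, (((x i : ℕ) : ℝ) • stdOrientation hmd i))
    refine ⟨q, hq, (ENNReal.ofReal_le_ofReal_iff (by positivity)).1 ?_⟩
    rw [← edist_dist, ← heq]
    exact (Metric.infEDist_anti hQ).trans ((le_iSup₂_of_le _ (mem_range_self x) le_rfl).trans hsup)
  choose q hq hdist using hex
  have hbound := fun n => scale_le_of_approx_patch hk hm hmd hε hε' hN hεN hδ hδ' hAN hAP hF n t Δ
    hΔ q hq fun x j => by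
      refine le_trans ?_ (hdist x)
      rw [dist_comm, dist_eq_norm, ← Real.norm_eq_abs]
      refine le_of_eq_of_le ?_ (PiLp.norm_apply_le _ j)
      rw [PiLp.sub_apply, PiLp.add_apply, PiLp.smul_apply, sum_smul_stdOrientation_apply,
        smul_eq_mul]
  have hlim := (tendsto_pow_atTop_nhds_zero_of_lt_one (gridMap_ratio_pos hN hδ).le
    (gridMap_ratio_lt_one hN hδ)).mul_const (4 / 3 * ((N : ℝ) - 1 + δ))
  rw [zero_mul] at hlim
  exact absurd (ge_of_tendsto' hlim hbound) (not_le.2 hΔ)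

end GridSystem

theorem theorem2p2 (k d m : ℕ) (hk : 2 ≤ k) (hd : 1 ≤ d) (hm : 1 ≤ m) (hmd : m ≤ d)
    (hk3 : d = 1 → 3 ≤ k) (ε : ℝ) (hε : 0 < ε) (hε' : ε < 1 / 8)
    (N : ℕ) (hN : N = ⌈1 / (8 * ε)⌉₊) (δ : ℝ) (hδ : 0 < δ) (hδ' : δ ≤ 1 / 24)
    (A : Finset (EuclideanSpace ℝ (Fin d))) (hA : A.Nonempty)
    (hAN : (A : Set (EuclideanSpace ℝ (Fin d))) ⊆ gridCube d N)
    (hAP : ∀ P ⊆ (A : Set (EuclideanSpace ℝ (Fin d))), ∀ Δ : ℝ, 0 < Δ →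
      ¬ IsArithmeticPatch k Δ (stdOrientation hmd) P) :
    (∃! F : Set (EuclideanSpace ℝ (Fin d)), IsAttractor (fun a : A => gridMap N δ a) F) ∧
    ∀ F : Set (EuclideanSpace ℝ (Fin d)), IsAttractor (fun a : A => gridMap N δ a) F →
      OpenSetCondition (fun a : A => gridMap N δ (a : EuclideanSpace ℝ (Fin d))) ∧
      (∀ Q ⊆ F, ¬ IsApproxAP k ε (stdOrientation hmd) Q) ∧
      dimH F = ENNReal.ofReal
        (Real.log (A.card : ℝ) / Real.log (((N : ℝ) - 1) / δ + 1)) := by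
  have hN2 : 2 ≤ N := by
    rw [hN, Nat.succ_le_iff, Nat.lt_ceil, Nat.cast_one, lt_div_iff₀ (by positivity)]
    linarith
  have hεN : ε * ((N : ℝ) - 1) ≤ 1 / 8 := by
    have h1 := Nat.ceil_lt_add_one (a := 1 / (8 * ε)) (by positivity)
    rw [← hN, ← sub_lt_iff_lt_add, lt_div_iff₀ (by positivity)] at h1
    linarith
  have hδ1 : δ < 1 := by linarith
  refine ⟨⟨_, (isAttractor_gridMap_iff hA hN2 hδ).2 rfl,
    fun F hF => (isAttractor_gridMap_iff hA hN2 hδ).1 hF⟩, fun F hF => ?_⟩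
  exact ⟨openSetCondition_gridMap hAN hN2 hδ hδ1,
    fun Q hQ => not_isApproxAP_of_subset_attractor hk hm hmd hε hε' hN2 hεN hδ hδ' hAN hAP hF hQ,
    dimH_attractor_gridMap hA hAN hN2 hδ hδ1 hF⟩
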